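/- A transduction from a finite nonempty alphabet $A$ to a finite alphabet $B$ is a set of pairs $(w,v)\in A^*\times B^*$. A cellular automaton transducer (CAT) consists of a finite set $S\supseteq A$ of cell states, a set $F\subseteq S$ of accepting states, a boundary symbol $\#\notin S$, and a map $\delta\colon (S\cup\{\#\})\times S\times(S\cup\{\#\})\to S\times(B^*\cup\{\bot\})$. On input $w=a_1\cdots a_n$ with $n\ge 1$ it has $n$ cells; at time $0$ cell $i$ is in state $a_i$ and its output register holds $\bot$ (empty). In every time step all cells synchronously apply $\delta$ to the states of their left neighbour, of themselves and of their right neighbour (with $\#$ for a missing neighbour); the first component is the new state, and the second component is written into the output register if that register still holds $\bot$ and is ignored otherwise. The input is accepted at time $t$ if the leftmost cell is in a state of $F$ at time $t$; the output is complete at time $t$ if no register holds $\bot$, and it is then the concatenation $v$ of the registers from left to right. The transduction computed by the CAT is the set of pairs $(w,v)$ with $w\ne\lambda$ such that $w$ is accepted at some time and the output is complete with value $v$ at some time. An iterative array transducer (IAT) consists of a finite set $S$ of cell states, a set $F\subseteq S$ of accepting states, a quiescent state $s_0\in S$, a total map $\delta\colon S^3\to S$ with $\delta(s_0,s_0,s_0)=s_0$,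 and a partial map $\delta_0\colon(A\cup\{\lhd\})\times S^2\to B^*\times S$, where $\lhd\notin A$ is the end-of-input symbol. Its cells are numbered $0,1,2,\dots$, cell $0$ being the communication cell; all cells are in state $s_0$ at time $0$. In every time step the communication cell reads the next input symbol (or $\lhd$ once the input is consumed), and applies $\delta_0$ to that symbol, its own state and the state of cell $1$, which yields a word that is appended to the output and its new state; simultaneously every other cell applies $\delta$ to the states of its left neighbour, of itself and of its right neighbour. The array halts when $\delta_0$ is undefined. The transduction computed by the IAT is the set of pairs $(w,v)$ such that, on input $w$, the communication cell is in a state of $F$ at some time of the computation, and the array halts with total output $v$. A transducer works in time (linear, linear) if there are rational numbers $k_i,k_o\ge 1$ such that, for every pair $(w,v)$ of its transduction, $w$ is accepted within $k_i|w|$ time steps, and within $k_o|w|$ time steps the output is complete (for a CAT) respectively the array has halted (for an IAT). Two transductions are considered equal if they differ at most in pairs whose input word is the empty word $\lambda$. Theorem. For every finite nonempty alphabet $A$ and every finite alphabet $B$, the family of transductions from $A$ to $B$ computed by IATs in time (linear, linear) and the family of transductions from $A$ to $B$ computed by CATs in time (linear, linear) are identical. -/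

import Mathlib

universe u v

/-- A transduction: a set of pairs (input word, output word) over the alphabets `A` and `B`. -/
abbrev Transduction (A : Type u) (B : Type v) := Set (List A × List B)

/-- A cellular automaton transducer with input alphabet `A` and output alphabet `B`.
Neighbour states lie in `Option S`, where `none` is the boundary symbol `#`;
outputs lie in `Option (List B)`, where `none` is the symbol `⊥` (no output so far). -/
structure CAT (A : Type u) (B : Type v) where
  /-- the cell states -/
  S : Type
  finite_S : Finite S
  nonempty_S : Nonempty S
  /-- the accepting states -/
  F : Set S
  /-- the inclusion of the input symbols into the states -/
  input : A ↪ S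
  /-- the local transition function, applied to (left neighbour, cell, right neighbour) -/
  δ : Option S → S → Option S → S × Option (List B)

namespace CAT

variable {A : Type u} {B : Type v}

/-- A configuration on `n` cells (cells are numbered from `0`): the states and the output
registers. -/
structure Config (M : CAT A B) (n : ℕ) where
  state : Fin n → M.S
  out : Fin n → Option (List B)

/-- What cell `i` sees on its left: the state of cell `i - 1`, or `#` for the leftmost cell. -/
def left (M : CAT A B) {n : ℕ} (c : Fin n → M.S) (i : Fin n) : Option M.S :=
  if i.val = 0 then none else some (c ⟨i.val - 1, lt_of_le_of_lt (Nat.sub_le _ _) i.isLt⟩)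

/-- What cell `i` sees on its right: the state of cell `i + 1`, or `#` for the rightmost cell. -/
def right (M : CAT A B) {n : ℕ} (c : Fin n → M.S) (i : Fin n) : Option M.S :=
  if h : i.val + 1 < n then some (c ⟨i.val + 1, h⟩) else none

/-- The global transition function: all cells change their states synchronously, and an output
register is written only as long as it is empty. -/
def step (M : CAT A B) {n : ℕ} (C : M.Config n) : M.Config n where
  state i := (M.δ (M.left C.state i) (C.state i) (M.right C.state i)).1
  out i :=
    match C.out i with
    | some x => some x
    | none => (M.δ (M.left C.state i) (C.state i) (M.right C.state i)).2

/-- The initial configuration on input `w`: one cell per input symbol, all registers empty. -/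
def init (M : CAT A B) (w : List A) : M.Config w.length where
  state i := M.input (w.get i)
  out _ := none

/-- The configuration on input `w` at time `t`. -/
def run (M : CAT A B) (w : List A) (t : ℕ) : M.Config w.length :=
  M.step^[t] (M.init w)

/-- At time `t` the leftmost cell is in an accepting state. -/
def AcceptsAt (M : CAT A B) (w : List A) (t : ℕ) : Prop :=
  ∃ h : 0 < w.length, (M.run w t).state ⟨0, h⟩ ∈ M.F

/-- At time `t` every output register is filled, and `v` is the concatenation of their contents
from left to right. -/
def EmitsAt (M : CAT A B) (w : List A) (v : List B) (t : ℕ) : Prop :=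
  ∃ x : Fin w.length → List B,
    (∀ i, (M.run w t).out i = some (x i)) ∧ v = (List.ofFn x).flatten

/-- The transduction `T(M)` realized by `M`; the input words are nonempty. -/
def transduction (M : CAT A B) : Transduction A B :=
  {p | p.1 ≠ [] ∧ (∃ t, M.AcceptsAt p.1 t) ∧ ∃ t, M.EmitsAt p.1 p.2 t}

/-- `M` is of time complexity `(tᵢ, tₒ)`. -/
def HasTime (M : CAT A B) (tᵢ tₒ : ℕ → ℚ) : Prop :=
  ∀ w v, (w, v) ∈ M.transduction →
    (∃ s : ℕ, (s : ℚ) ≤ tᵢ w.length ∧ M.AcceptsAt w s) ∧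
    (∃ s : ℕ, (s : ℚ) ≤ tₒ w.length ∧ M.EmitsAt w v s)

end CAT

/-- An iterative array transducer with input alphabet `A` and output alphabet `B`.
Symbols read by the communication cell lie in `Option A`, where `none` is the end-of-input
symbol; the value `none` of `δ₀` means that `δ₀` is undefined. -/
structure IAT (A : Type u) (B : Type v) where
  /-- the cell states -/
  S : Type
  finite_S : Finite S
  /-- the accepting states -/
  F : Set S
  /-- the quiescent state -/
  s₀ : S
  /-- the transition function of the non-communication cells, applied to
  (left neighbour, cell, right neighbour) -/
  δ : S → S → S → S
  δ_quiescent : δ s₀ s₀ s₀ = s₀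
  /-- the partial transition function of the communication cell, applied to
  (symbol read, cell, right neighbour) -/
  δ₀ : Option A → S → S → Option (List B × S)

namespace IAT

variable {A : Type u} {B : Type v}

/-- A configuration: the states of the cells (cell `0` is the communication cell), and the output
emitted so far. -/
structure Config (M : IAT A B) where
  state : ℕ → M.S
  out : List B

/-- The states of all cells after a step in which the communication cell enters `s`. -/
def nextState (M : IAT A B) (c : ℕ → M.S) (s : M.S) : ℕ → M.S
  | 0 => s
  | i + 1 => M.δ (c i) (c (i + 1)) (c (i + 2))

/-- One step in which the communication cell reads `a`; undefined if `δ₀` is. -/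
def step (M : IAT A B) (a : Option A) (C : M.Config) : Option M.Config :=
  (M.δ₀ a (C.state 0) (C.state 1)).map fun r =>
    { state := M.nextState C.state r.2, out := C.out ++ r.1 }

/-- The configuration on input `w` at time `t`, or `none` if the array has halted before time `t`.
Note that `w[t]?` is the symbol at position `t` (counted from `0`), and `none`, the end-of-input
symbol, once the input is consumed. -/
def run (M : IAT A B) (w : List A) : ℕ → Option M.Config
  | 0 => some { state := fun _ => M.s₀, out := [] }
  | t + 1 => (M.run w t).bind (M.step w[t]?)

/-- At time `t` of the computation the communication cell is in an accepting state. -/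
def AcceptsAt (M : IAT A B) (w : List A) (t : ℕ) : Prop :=
  ∃ C, M.run w t = some C ∧ C.state 0 ∈ M.F

/-- The array halts at time `t`, with total output `v`. -/
def HaltsAt (M : IAT A B) (w : List A) (v : List B) (t : ℕ) : Prop :=
  ∃ C, M.run w t = some C ∧ C.out = v ∧ M.run w (t + 1) = none

/-- The transduction `T(M)` computed by `M`. -/
def transduction (M : IAT A B) : Transduction A B :=
  {p | (∃ t, M.AcceptsAt p.1 t) ∧ ∃ t, M.HaltsAt p.1 p.2 t}

/-- `M` is of time complexity `(tᵢ, tₒ)`. -/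
def HasTime (M : IAT A B) (tᵢ tₒ : ℕ → ℚ) : Prop :=
  ∀ w v, (w, v) ∈ M.transduction →
    (∃ s : ℕ, (s : ℚ) ≤ tᵢ w.length ∧ M.AcceptsAt w s) ∧
    (∃ s : ℕ, (s : ℚ) ≤ tₒ w.length ∧ M.HaltsAt w v s)

end IAT

/-- The family of transductions from `A` to `B` computed by cellular automaton transducers of time
complexity `(tᵢ, tₒ)`. -/
def familyCAT (A : Type u) (B : Type v) (tᵢ tₒ : ℕ → ℚ) : Set (Transduction A B) :=
  {T | ∃ M : CAT A B, M.HasTime tᵢ tₒ ∧ M.transduction = T}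

/-- The family of transductions from `A` to `B` computed by iterative array transducers of time
complexity `(tᵢ, tₒ)`. -/
def familyIAT (A : Type u) (B : Type v) (tᵢ tₒ : ℕ → ℚ) : Set (Transduction A B) :=
  {T | ∃ M : IAT A B, M.HasTime tᵢ tₒ ∧ M.transduction = T}

/-- Linear time: `t(n) = k · n` for a rational number `k ≥ 1`. -/
def IsLinearTime (t : ℕ → ℚ) : Prop :=
  ∃ k : ℚ, 1 ≤ k ∧ ∀ n : ℕ, t n = k * n

/-- The family of time complexity (linear time, linear time) for cellular automaton transducers. -/
def familyCATltlt (A : Type u) (B : Type v) : Set (Transduction A B) :=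
  {T | ∃ tᵢ tₒ, IsLinearTime tᵢ ∧ IsLinearTime tₒ ∧ T ∈ familyCAT A B tᵢ tₒ}

/-- The family of time complexity (linear time, linear time) for iterative array transducers. -/
def familyIATltlt (A : Type u) (B : Type v) : Set (Transduction A B) :=
  {T | ∃ tᵢ tₒ, IsLinearTime tᵢ ∧ IsLinearTime tₒ ∧ T ∈ familyIAT A B tᵢ tₒ}

/-- The transduction `T` without its pairs whose input word is empty. -/
def Transduction.dropEmptyInput {A : Type u} {B : Type v} (T : Transduction A B) :
    Transduction A B :=
  {p | p ∈ T ∧ p.1 ≠ []}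

/-! ### Cellular automata with bookkeeping, and their space-time diagrams -/

namespace CAT

variable {A : Type u} {B : Type v}

/-! Each model simulates the other with linear delay. The time bounds may be taken to be `k * n`
with a natural number `k ≥ 1`.

From CAT to IAT: on an input of length `n`, every pair of the transduction is accepted and its
output is complete by time `n * k`, so row `n * k` of the space-time diagram tells everything, once
cells remember whether they have accepted and what they have output. An output is remembered through
the arguments of `δ` that produced it, which keeps the state set finite. A slow signal from the
right end singles out this row. Cell `t` of the array computes row `t` entry by entry
(`streamIAT_window`); the marked row is reflected to the communication cell (`streamIAT_back`),
which emits the registers in order and never halts if one is empty (`streamIAT_phase`).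

From IAT to CAT: each of the `n` cells simulates `K = k + 2` array cells while the input shifts
left. Array cells beyond `n * K` are unknown, but this ignorance spreads left by one cell per step,
too slowly to disturb the communication cell in the first `k * n` steps (`known_eq_some`). The
output has to be spread over `n` registers that are written once: each cell retains the first `K`
communication events that reach it and forwards the others, and a final halting message makes it
write their words (`block_spec`). An IAT may accept the empty word and a CAT cannot, hence the
restriction to nonempty inputs. -/

theorem run_succ (M : CAT A B) (w : List A) (t : ℕ) :
    M.run w (t + 1) = M.step (M.run w t) :=
  Function.iterate_succ_apply' ..

/-- A cell state together with the arguments for which the output register was last computed, the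
information whether the cell has been in an accepting state, and the counter of a signal that
crosses one cell in `k` steps. -/
structure Tracked (M : CAT A B) (k : ℕ) where
  state : M.S
  origin : Option (Option M.S × M.S × Option M.S)
  seen : Prop
  count : Fin (k + 2)

namespace Tracked

variable {M : CAT A B} {k : ℕ}

instance : Finite (M.Tracked k) := by
  have := M.finite_S
  refine Finite.of_injective (fun s : M.Tracked k => (s.state, s.origin, s.seen, s.count)) ?_
  rintro ⟨⟩ ⟨⟩ h
  simpa using h

/-- The content of the output register. -/
def out (s : M.Tracked k) : Option (List B) :=
  s.origin.bind fun p => (M.δ p.1 p.2.1 p.2.2).2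

/-- The tracked state of a cell with input symbol `a` at time `0`. -/
def start (M : CAT A B) (k : ℕ) (a : A) : M.Tracked k :=
  ⟨M.input a, none, M.input a ∈ M.F, 0⟩

open Classical in
/-- The local transition function on tracked states. -/
noncomputable def next (l : Option (M.Tracked k)) (s : M.Tracked k) (r : Option (M.Tracked k)) :
    M.Tracked k where
  state := (M.δ (l.map state) s.state (r.map state)).1
  origin := if s.out.isSome then s.origin else some (l.map state, s.state, r.map state)
  seen := s.seen ∨ (M.δ (l.map state) s.state (r.map state)).1 ∈ M.F
  count := if ∀ q ∈ r, k ≤ q.count.val then ⟨min (k + 1) (s.count + 1), by omega⟩ else s.count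

end Tracked

end CAT

/-- The space-time diagram of a one-dimensional cellular automaton with local transition function
`f` on the cells `0, …, w.length - 1`; all other cells are `none`. -/
def cellRow {A : Type u} {Q : Type} (start : A → Q) (f : Option Q → Q → Option Q → Q)
    (w : List A) : ℕ → ℤ → Option Q
  | 0, i => if 0 ≤ i then w[i.toNat]?.map start else none
  | t + 1, i => (cellRow start f w t i).map fun s =>
      f (cellRow start f w t (i - 1)) s (cellRow start f w t (i + 1))

theorem cellRow_isSome {A : Type u} {Q : Type} (start : A → Q) (f : Option Q → Q → Option Q → Q)
    (w : List A) (t : ℕ) (i : ℤ) :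
    (cellRow start f w t i).isSome ↔ 0 ≤ i ∧ i < w.length := by
  induction t with
  | zero =>
    simp only [cellRow]
    split_ifs with h
    · simp; omega
    · simp; omega
  | succ t ih => simpa [cellRow] using ih

theorem cellRow_eq_none {A : Type u} {Q : Type} (start : A → Q) (f : Option Q → Q → Option Q → Q)
    (w : List A) (t : ℕ) {i : ℤ} (h : i < 0 ∨ w.length ≤ i) : cellRow start f w t i = none := by
  have := (cellRow_isSome start f w t i).not
  rw [Option.not_isSome_iff_eq_none] at this
  exact this.2 (by omega)

namespace CAT

variable {A : Type u} {B : Type v}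

/-- The rightmost cell counts from time `0`, and every other cell starts when its right neighbour
has reached `k`, so the signal spends `k` steps in each cell. The counter saturates at `k + 1`, so
that the value `k` occurs at a single time. -/
theorem cellRow_tracked (M : CAT A B) {k : ℕ} (hk : 1 ≤ k) (w : List A) (t : ℕ)
    (i : Fin w.length) :
    ∃ s, cellRow (Tracked.start M k) Tracked.next w t i = some s ∧
      s.state = (M.run w t).state i ∧ s.out = (M.run w t).out i ∧
      (s.seen ↔ ∃ t' ≤ t, (M.run w t').state i ∈ M.F) ∧
      s.count.val = min (k + 1) (t - (w.length - 1 - i) * k) := by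
  induction t generalizing i with
  | zero =>
    refine ⟨Tracked.start M k w[i], ?_, ?_, ?_, ?_, ?_⟩
    · simp [cellRow]
    · simp [run, init, Tracked.start]
    · simp [run, init, Tracked.start, Tracked.out]
    · simp [run, init, Tracked.start]
    · simp [Tracked.start]
  | succ t ih =>
    obtain ⟨s, hs, h1, h2, h3, h4⟩ := ih i
    have hl : (cellRow (Tracked.start M k) Tracked.next w t (i - 1)).map Tracked.state =
        M.left (M.run w t).state i := by
      unfold left
      split_ifs with h
      · rw [cellRow_eq_none _ _ _ _ (by omega)]; rfl
      · obtain ⟨q, hq, hq1, -⟩ := ih ⟨i - 1, by omega⟩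
        have : (((⟨i - 1, by omega⟩ : Fin w.length) : ℕ) : ℤ) = i - 1 := by simp; omega
        rw [this] at hq
        rw [hq, Option.map_some, hq1]
    have hr : (cellRow (Tracked.start M k) Tracked.next w t (i + 1)).map Tracked.state =
        M.right (M.run w t).state i := by
      unfold right
      split_ifs with h
      · obtain ⟨q, hq, hq1, -⟩ := ih ⟨i + 1, h⟩
        push_cast at hq
        rw [hq, Option.map_some, hq1]
      · rw [cellRow_eq_none _ _ _ _ (by omega)]; rfl
    refine ⟨_, by rw [cellRow, hs, Option.map_some], ?_, ?_, ?_, ?_⟩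
    · simp only [Tracked.next, hl, hr, h1, run_succ, step]
    · simp only [run_succ, step, ← h2]
      cases ho : s.out with
      | some x =>
        simp only [Tracked.out] at ho
        simp [Tracked.next, Tracked.out, ho]
      | none =>
        simp only [Tracked.next, ho, hl, hr, h1, Option.isSome_none, Bool.false_eq_true, if_false]
        rfl
    · simp only [Tracked.next, hl, hr, h1, h3]
      have : (M.δ (M.left (M.run w t).state i) ((M.run w t).state i)
          (M.right (M.run w t).state i)).1 = (M.run w (t + 1)).state i := by
        rw [run_succ]; rfl
      rw [this]
      constructor
      · rintro (⟨t', h, h'⟩ | h)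
        · exact ⟨t', by omega, h'⟩
        · exact ⟨_, le_rfl, h⟩
      · rintro ⟨t', h, h'⟩
        rcases Nat.le_succ_iff.1 h with h | rfl
        · exact .inl ⟨t', h, h'⟩
        · exact .inr h'
    · simp only [Tracked.next]
      by_cases h : i.val + 1 < w.length
      · obtain ⟨q, hq, -, -, -, hq4⟩ := ih ⟨i + 1, h⟩
        push_cast at hq
        have e : w.length - 1 - i = (w.length - 1 - (i + 1)) + 1 := by omega
        rw [e, add_mul, one_mul] at h4 ⊢
        simp only [hq, Option.mem_def, Option.some.injEq, forall_eq']
        dsimp only at hq4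
        generalize (w.length - 1 - (i.val + 1)) * k = D at *
        split_ifs <;> (try dsimp only) <;> omega
      · rw [cellRow_eq_none _ _ _ _ (i := (i : ℤ) + 1) (by omega)]
        have e : w.length - 1 - i = 0 := by omega
        rw [e, zero_mul] at h4 ⊢
        simp
        omega

end CAT

/-! ### Streaming the rows of a space-time diagram through an iterative array -/

/-- The phases of the communication cell of a streaming iterative array: waiting for the final row,
receiving it, or being stuck since some cell of the final row has produced no output. -/
inductive StreamPhase
  | waiting
  | receiving
  | stuck

/-- The cell states of a streaming iterative array: a window of three consecutive entries of a row
of a space-time diagram, the information whether the cell sends this row back to the communication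
cell, and an entry of the row sent back. The last two components belong to the communication
cell. -/
structure StreamState (Q : Type) where
  cur : Option Q
  prev : Option Q
  prev₂ : Option Q
  mirror : Prop
  back : Option Q
  phase : StreamPhase
  acc : Prop

namespace StreamState

variable {Q : Type}

instance [Finite Q] : Finite (StreamState Q) := by
  have : Finite StreamPhase := by
    refine Finite.of_injective (β := Fin 3) (fun | .waiting => 0 | .receiving => 1 | .stuck => 2) ?_
    rintro (_ | _ | _) (_ | _ | _) h <;> simp_all
  refine Finite.of_injective
    (fun s : StreamState Q => (s.cur, s.prev, s.prev₂, s.mirror, s.back, s.phase, s.acc)) ?_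
  rintro ⟨⟩ ⟨⟩ h
  simpa using h

/-- The first entry of the final row has arrived. -/
def Detects (last : Q → Prop) (c : StreamState Q) : Prop :=
  c.prev = none ∧ ∃ s ∈ c.cur, last s

open Classical in
/-- The transition function of the cells other than the communication cell. -/
noncomputable def next (f : Option Q → Q → Option Q → Q) (last : Q → Prop)
    (l c r : StreamState Q) : StreamState Q where
  cur := l.prev.map fun s => f l.prev₂ s l.cur
  prev := c.cur
  prev₂ := c.prev
  mirror := c.mirror ∨ c.Detects last
  back := if c.mirror ∨ c.Detects last then c.cur else r.back
  phase := .waiting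
  acc := False

/-- The state of the communication cell after reading `a`. -/
def read (a : Option Q) (c : StreamState Q) (phase : StreamPhase) (acc : Prop) : StreamState Q :=
  ⟨a, c.cur, c.prev, False, none, phase, acc⟩

end StreamState

section

variable {A : Type u} {B : Type v} {Q : Type}

open StreamState in
/-- The iterative array whose cell `t` computes, entry by entry, row `t` of the space-time diagram
of a cellular automaton. The row whose first entry satisfies `last` is sent back to the
communication cell, which emits the outputs of its entries and accepts if its first entry
satisfies `seen`. -/
noncomputable def streamIAT [Finite Q] (start : A → Q) (f : Option Q → Q → Option Q → Q)
    (last seen : Q → Prop) (out : Q → Option (List B)) : IAT A B where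
  S := StreamState Q
  finite_S := inferInstance
  F := {s | s.acc}
  s₀ := ⟨none, none, none, False, none, .waiting, False⟩
  δ := next f last
  δ_quiescent := by simp [next, Detects]
  δ₀ a c r :=
    match c.phase, r.back with
    | .waiting, none => some ([], read (a.map start) c .waiting False)
    | .waiting, some s => some ((out s).getD [],
        read (a.map start) c (if (out s).isSome then .receiving else .stuck) (seen s))
    | .receiving, none => none
    | .receiving, some s => some ((out s).getD [],
        read (a.map start) c (if (out s).isSome then .receiving else .stuck) c.acc)
    | .stuck, _ => some ([], read (a.map start) c .stuck c.acc)

variable [Finite Q] (start : A → Q) (f : Option Q → Q → Option Q → Q)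
    (last seen : Q → Prop) (out : Q → Option (List B)) (w : List A)

theorem IAT.run_succ_eq_some {M : IAT A B} {w : List A} {t : ℕ} {C' : M.Config} :
    M.run w (t + 1) = some C' ↔ ∃ C r, M.run w t = some C ∧
      M.δ₀ w[t]? (C.state 0) (C.state 1) = some r ∧
      C' = { state := M.nextState C.state r.2, out := C.out ++ r.1 } := by
  simp only [run, step, Option.bind_eq_some_iff, Option.map_eq_some_iff]
  constructor
  · rintro ⟨C, h, r, h', rfl⟩; exact ⟨C, r, h, h', rfl⟩
  · rintro ⟨C, r, h, h', rfl⟩; exact ⟨C, h, r, h', rfl⟩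

theorem streamIAT_delta_eq_some {a : Option A} {c r : StreamState Q}
    {p : List B × StreamState Q} (h : (streamIAT start f last seen out).δ₀ a c r = some p) :
    ∃ ph acc, p.2 = StreamState.read (a.map start) c ph acc := by
  simp only [streamIAT] at h
  split at h <;> cases h <;> exact ⟨_, _, rfl⟩

/-- Each row lags two steps behind the previous one: one step for the transfer to the next cell, one
for waiting until the right neighbour's entry is available. The window of three entries is exactly
what `f` needs. -/
theorem streamIAT_window {t : ℕ} {C : (streamIAT start f last seen out).Config}
    (h : (streamIAT start f last seen out).run w t = some C) (x : ℕ) :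
    (C.state x).cur = cellRow start f w x (t - 1 - 2 * x) ∧
    (C.state x).prev = cellRow start f w x (t - 2 - 2 * x) ∧
    (C.state x).prev₂ = cellRow start f w x (t - 3 - 2 * x) := by
  induction t generalizing C x with
  | zero =>
    cases h
    refine ⟨?_, ?_, ?_⟩ <;> rw [cellRow_eq_none _ _ _ _ (by omega)] <;> rfl
  | succ t ih =>
    obtain ⟨C, p, hC, hp, rfl⟩ := IAT.run_succ_eq_some.1 h
    have key := fun x => ih hC x
    have e1 : ((t + 1 : ℕ) : ℤ) - 1 = t := by omega
    have e2 : ((t + 1 : ℕ) : ℤ) - 2 = t - 1 := by omega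
    have e3 : ((t + 1 : ℕ) : ℤ) - 3 = t - 2 := by omega
    rw [e1, e2, e3]
    cases x with
    | zero =>
      obtain ⟨ph, acc, e⟩ := streamIAT_delta_eq_some _ _ _ _ _ hp
      obtain ⟨k1, k2, k3⟩ := key 0
      simp only [IAT.nextState, e, StreamState.read]
      refine ⟨by simp [cellRow], k1, k2⟩
    | succ x =>
      obtain ⟨k1, k2, k3⟩ := key (x + 1)
      obtain ⟨l1, l2, l3⟩ := key x
      refine ⟨?_, k1, k2⟩
      change ((C.state x).prev.map fun s => f (C.state x).prev₂ s (C.state x).cur) = _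
      rw [l1, l2, l3, cellRow]
      push_cast
      have d2 : (t : ℤ) - 2 * (x + 1) = t - 2 - 2 * x := by ring
      rw [d2]
      congr! 3 <;> ring_nf

-- Among first entries of rows, `last` singles out row `X`. Positivity of `X` on nonempty input
-- ensures that the reflecting cell is not the communication cell.
variable {last w} {X : ℕ}
  (hX : ∀ t s, cellRow start f w t 0 = some s → (last s ↔ t = X)) (hX0 : 0 < X ↔ w ≠ [])
include hX hX0

open Classical in
-- Entry `i` of row `X` is current in cell `X` at time `2 * X + 1 + i`, is reflected in the next
-- step, and then moves left by one cell per step. It thus reaches cell `x` at time `2 * X + 2 + i +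
-- (X - x)`.
theorem streamIAT_back {t : ℕ} {C : (streamIAT start f last seen out).Config}
    (h : (streamIAT start f last seen out).run w t = some C) (x : ℕ) (hx : 1 ≤ x) :
    ((C.state x).mirror ↔ x = X ∧ 2 * X + 2 ≤ t) ∧
    (C.state x).back = if x ≤ X then cellRow start f w X (t - 2 - 3 * X + x) else none := by
  have hlen : 0 < X ↔ 0 < w.length := by rw [hX0, List.length_pos_iff]
  induction t generalizing C x with
  | zero =>
    cases h
    refine ⟨?_, ?_⟩
    · simp [streamIAT]
    · split_ifs
      · rw [cellRow_eq_none _ _ _ _ (by omega)]; rfl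
      · rfl
  | succ t ih =>
    obtain ⟨C, p, hC, hp, rfl⟩ := IAT.run_succ_eq_some.1 h
    obtain ⟨x, rfl⟩ : ∃ y, x = y + 1 := ⟨x - 1, by omega⟩
    obtain ⟨k1, k2, -⟩ := streamIAT_window start f last seen out w hC (x + 1)
    obtain ⟨m1, m2⟩ := ih hC (x + 1) (by omega)
    obtain ⟨-, m3⟩ := ih hC (x + 2) (by omega)
    have hd : (C.state (x + 1)).Detects last ↔ x + 1 = X ∧ t = 2 * X + 1 := by
      unfold StreamState.Detects
      rw [k1, k2]
      constructor
      · rintro ⟨h1, s, h2, h3⟩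
        -- A nonempty entry preceded by an empty one has index `0`, so `hX` applies.
        have i1 := (cellRow_isSome start f w (x + 1) (t - 1 - 2 * (x + 1 : ℕ))).1
          (by rw [Option.mem_def] at h2; rw [h2]; rfl)
        have i2 := (cellRow_isSome start f w (x + 1) (t - 2 - 2 * (x + 1 : ℕ))).2.mt
          (by rw [h1]; simp)
        have e : (t : ℤ) - 1 - 2 * (x + 1 : ℕ) = 0 := by omega
        rw [e] at h2
        have := (hX _ _ h2).1 h3
        omega
      · rintro ⟨rfl, rfl⟩
        have e : ((2 * (x + 1) + 1 : ℕ) : ℤ) - 1 - 2 * (x + 1 : ℕ) = 0 := by omega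
        refine ⟨cellRow_eq_none _ _ _ _ (by omega), ?_⟩
        rw [e]
        obtain ⟨s, hs⟩ := Option.isSome_iff_exists.1
          ((cellRow_isSome start f w (x + 1) 0).2 (by omega))
        exact ⟨s, hs, (hX _ _ hs).2 rfl⟩
    have hmd : ((C.state (x + 1)).mirror ∨ (C.state (x + 1)).Detects last) ↔
        x + 1 = X ∧ 2 * X + 1 ≤ t := by
      rw [m1, hd]; omega
    constructor
    · change (_ ∨ _) ↔ _
      rw [hmd]; omega
    · change (if (C.state (x + 1)).mirror ∨ (C.state (x + 1)).Detects last
        then (C.state (x + 1)).cur else (C.state (x + 2)).back) = _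
      rw [m3, k1]
      by_cases hx : x + 1 = X
      · subst hx
        rw [if_pos le_rfl, if_neg (by omega : ¬ x + 2 ≤ x + 1)]
        have e : ((t + 1 : ℕ) : ℤ) - 2 - 3 * (x + 1 : ℕ) + (x + 1 : ℕ) = t - 1 - 2 * (x + 1 : ℕ) := by
          omega
        rw [e]
        split_ifs with hc
        · rfl
        -- Before the reflection starts, the index is negative and both sides are empty.
        · rw [hmd] at hc
          rw [cellRow_eq_none _ _ _ _ (by omega)]
      · rw [if_neg (by rw [hmd]; omega)]
        have e : ((t + 1 : ℕ) : ℤ) - 2 - 3 * X + (x + 1 : ℕ) = t - 2 - 3 * X + (x + 2 : ℕ) := by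
          omega
        rw [e]
        congr 1
        simp; omega

theorem streamIAT_received {t : ℕ} {C : (streamIAT start f last seen out).Config}
    (h : (streamIAT start f last seen out).run w t = some C) :
    (C.state 1).back = cellRow start f w X (t - 1 - 3 * X) := by
  rw [(streamIAT_back start f seen out hX hX0 h 1 le_rfl).2]
  split_ifs with h1
  · congr 1; omega
  · have : w = [] := by by_contra h; exact h1 (hX0.2 h)
    rw [cellRow_eq_none]
    rw [this, List.length_nil]
    omega

end

/-! ### Output and acceptance of the streaming array -/

section

variable {A : Type u} {B : Type v} {Q : Type} [Finite Q] (start : A → Q)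
    (f : Option Q → Q → Option Q → Q) (last seen : Q → Prop) (out : Q → Option (List B))
    (w : List A)

/-- The output of cell `i` at time `t` of a space-time diagram. -/
def cellOut (t i : ℕ) : Option (List B) :=
  (cellRow start f w t i).bind out

variable {last w} {X : ℕ}
  (hX : ∀ t s, cellRow start f w t 0 = some s → (last s ↔ t = X)) (hX0 : 0 < X ↔ w ≠ [])
include hX hX0

/-- Entry `j` of row `X` is consumed in the step that starts at time `3 * X + 1 + j`. The array is
receiving as long as all entries consumed so far carry an output; the first one without output makes
it stuck for good. -/
theorem streamIAT_phase {t : ℕ} {C : (streamIAT start f last seen out).Config}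
    (h : (streamIAT start f last seen out).run w t = some C) :
    ((C.state 0).phase = .waiting ∧ (w ≠ [] → t ≤ 3 * X + 1) ∧ ¬ (C.state 0).acc ∧ C.out = []) ∨
    ((C.state 0).phase = .receiving ∧ ∃ i, 1 ≤ i ∧ i ≤ w.length ∧ t = 3 * X + 1 + i ∧
      ((C.state 0).acc ↔ ∃ s, cellRow start f w X 0 = some s ∧ seen s) ∧
      (∀ j < i, (cellOut start f out w X j).isSome) ∧
      C.out = ((List.range i).map fun j => (cellOut start f out w X j).getD []).flatten) ∨
    ((C.state 0).phase = .stuck ∧ w ≠ [] ∧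
      ((C.state 0).acc ↔ ∃ s, cellRow start f w X 0 = some s ∧ seen s) ∧
      ∃ j < w.length, cellOut start f out w X j = none) := by
  induction t generalizing C with
  | zero =>
    cases h
    exact .inl ⟨rfl, by omega, id, rfl⟩
  | succ t ih =>
    obtain ⟨C, p, hC, hp, rfl⟩ := IAT.run_succ_eq_some.1 h
    have hb := streamIAT_received start f seen out hX hX0 hC
    have hs := cellRow_isSome start f w X (t - 1 - 3 * X)
    rw [← hb] at hs
    have hlen : w ≠ [] ↔ 0 < w.length := List.length_pos_iff.symm
    -- Consuming entry `i` has the same effect whether it is the first one, met while waiting, or a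
    -- later one.
    have hstep : ∀ {s : Q} {i : ℕ} {ph : StreamPhase} {acc : Prop} {b : List B},
        (C.state 1).back = some s → t = 3 * X + 1 + i →
        (acc ↔ ∃ s, cellRow start f w X 0 = some s ∧ seen s) →
        (∀ j < i, (cellOut start f out w X j).isSome) →
        b = ((List.range i).map fun j => (cellOut start f out w X j).getD []).flatten →
        ph = (if (out s).isSome then .receiving else .stuck) →
        (ph = .receiving ∧ ∃ i, 1 ≤ i ∧ i ≤ w.length ∧ t + 1 = 3 * X + 1 + i ∧
          (acc ↔ ∃ s, cellRow start f w X 0 = some s ∧ seen s) ∧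
          (∀ j < i, (cellOut start f out w X j).isSome) ∧
          b ++ (out s).getD [] =
            ((List.range i).map fun j => (cellOut start f out w X j).getD []).flatten) ∨
        (ph = .stuck ∧ w ≠ [] ∧ (acc ↔ ∃ s, cellRow start f w X 0 = some s ∧ seen s) ∧
          ∃ j < w.length, cellOut start f out w X j = none) := by
      intro s i ph acc b hs' ht hacc hall hout hph
      rw [hs'] at hs hb
      have hi := hs.1 rfl
      have e : (t : ℤ) - 1 - 3 * X = i := by omega
      rw [e] at hb
      have ho : cellOut start f out w X i = out s := by simp [cellOut, ← hb]
      cases hos : out s with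
      | none =>
        rw [hos] at hph ho
        exact .inr ⟨by simpa using hph, hlen.2 (by omega), hacc, i, by omega, ho⟩
      | some x =>
        rw [hos] at hph ho
        refine .inl ⟨by simpa using hph, i + 1, by omega, by omega, by omega, hacc, ?_, ?_⟩
        · intro j hj
          rcases Nat.lt_succ_iff_lt_or_eq.1 hj with hj | rfl
          · exact hall j hj
          · simp [ho]
        · simp [List.range_succ, hout, ho]
    rcases ih hC with ⟨h1, h2, h3, h4⟩ | ⟨h1, i, h2, h3, h4, h5, h6, h7⟩ | ⟨h1, h2, h3, h4⟩
    · cases hs' : (C.state 1).back with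
      | none =>
        simp only [streamIAT, h1, hs'] at hp
        obtain rfl := Option.some.inj hp
        refine .inl ⟨rfl, fun hw => ?_, id, by simpa using h4⟩
        by_contra hlt
        rw [hs'] at hs
        have := h2 hw
        have := hs.2 (by have := hlen.1 hw; omega)
        simp at this
      | some s =>
        simp only [streamIAT, h1, hs'] at hp
        obtain rfl := Option.some.inj hp
        have hi := hs.1 (by simp [hs'])
        have ht : t = 3 * X + 1 + 0 := by
          have := h2 (hlen.2 (by omega)); omega
        refine .inr (hstep hs' ht ?_ (by simp) (by simpa using h4) rfl)
        have e : (t : ℤ) - 1 - 3 * X = 0 := by omega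
        rw [e, hs'] at hb
        simp [← hb]
        exact Iff.rfl
    · cases hs' : (C.state 1).back with
      | none => simp [streamIAT, h1, hs'] at hp
      | some s =>
        simp only [streamIAT, h1, hs'] at hp
        obtain rfl := Option.some.inj hp
        exact .inr (hstep hs' h4 h5 h6 h7 rfl)
    · simp only [streamIAT, h1] at hp
      obtain rfl := Option.some.inj hp
      exact .inr (.inr ⟨rfl, h2, h3, h4⟩)

theorem streamIAT_acceptsAt {t : ℕ} (h : (streamIAT start f last seen out).AcceptsAt w t) :
    w ≠ [] ∧ ∃ s, cellRow start f w X 0 = some s ∧ seen s := by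
  obtain ⟨C, hC, hF⟩ := h
  change (C.state 0).acc at hF
  rcases streamIAT_phase start f seen out hX hX0 hC with
    ⟨-, -, h3, -⟩ | ⟨-, i, h2, h3, -, h5, -⟩ | ⟨-, h2, h3, -⟩
  · exact absurd hF h3
  · exact ⟨List.length_pos_iff.1 (by omega), h5.1 hF⟩
  · exact ⟨h2, h3.1 hF⟩

/-- `δ₀` is undefined only in the receiving phase when no further entry arrives, that is, when the
whole row has been consumed. -/
theorem streamIAT_haltsAt {v : List B} {t : ℕ}
    (h : (streamIAT start f last seen out).HaltsAt w v t) :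
    (∀ j < w.length, (cellOut start f out w X j).isSome) ∧
      v = ((List.range w.length).map fun j => (cellOut start f out w X j).getD []).flatten := by
  obtain ⟨C, hC, rfl, hN⟩ := h
  simp only [IAT.run, hC, Option.bind_some, IAT.step, Option.map_eq_none_iff] at hN
  have hb := streamIAT_received start f seen out hX hX0 hC
  rcases streamIAT_phase start f seen out hX hX0 hC with
    ⟨h1, -⟩ | ⟨h1, i, h2, h3, h4, h5, h6, h7⟩ | ⟨h1, -⟩
  · cases hs' : (C.state 1).back <;> simp [streamIAT, h1, hs'] at hN
  · cases hs' : (C.state 1).back with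
    | some s => simp [streamIAT, h1, hs'] at hN
    | none =>
      have hi : i = w.length := by
        by_contra hi
        have := (cellRow_isSome start f w X (t - 1 - 3 * X)).2 (by omega)
        rw [← hb, hs'] at this
        simp at this
      subst hi
      exact ⟨h6, h7⟩
  · simp [streamIAT, h1] at hN

theorem streamIAT_complete (hw : w ≠ [])
    (hacc : ∃ s, cellRow start f w X 0 = some s ∧ seen s)
    (hout : ∀ j < w.length, (cellOut start f out w X j).isSome) :
    (streamIAT start f last seen out).AcceptsAt w (3 * X + 2) ∧
    (streamIAT start f last seen out).HaltsAt w
      ((List.range w.length).map fun j => (cellOut start f out w X j).getD []).flatten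
      (3 * X + 1 + w.length) := by
  have hlen := List.length_pos_iff.2 hw
  have hphase : ∀ {t C}, (streamIAT start f last seen out).run w t = some C → 3 * X + 1 < t →
      (C.state 0).phase = .receiving ∧ (C.state 0).acc ∧ C.out = ((List.range (t - (3 * X + 1))).map
        fun j => (cellOut start f out w X j).getD []).flatten := by
    intro t C hC ht
    rcases streamIAT_phase start f seen out hX hX0 hC with
      ⟨-, h, -⟩ | ⟨h1, i, h2, h3, h4, h5, h6, h7⟩ | ⟨h1, -, -, j, hj, hj'⟩
    · exact absurd (h hw) (by omega)
    · refine ⟨h1, h5.2 hacc, ?_⟩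
      rw [h7, h4, Nat.add_sub_cancel_left]
    · have := hout j hj
      simp [hj'] at this
  have hrun : ∀ t, t ≤ 3 * X + 1 + w.length →
      ∃ C, (streamIAT start f last seen out).run w t = some C := by
    intro t
    induction t with
    | zero => exact fun _ => ⟨_, rfl⟩
    | succ t ih =>
      intro ht
      obtain ⟨C, hC⟩ := ih (by omega)
      rw [← Option.isSome_iff_exists, IAT.run, hC, Option.bind_some, IAT.step, Option.isSome_map]
      have hb := streamIAT_received start f seen out hX hX0 hC
      have hs := cellRow_isSome start f w X (t - 1 - 3 * X)
      rw [← hb] at hs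
      cases hs' : (C.state 1).back with
      | none =>
        rw [hs'] at hs
        have hlt : t < 3 * X + 1 := by
          by_contra hlt
          have := hs.2 (by omega)
          simp at this
        rcases streamIAT_phase start f seen out hX hX0 hC with ⟨h1, -⟩ | ⟨h1, i, h⟩ | ⟨h1, -⟩
        · simp [streamIAT, h1, hs']
        · omega
        · simp [streamIAT, h1]
      | some s =>
        rcases h1 : (C.state 0).phase <;> simp [streamIAT, h1, hs']
  obtain ⟨C, hC⟩ := hrun (3 * X + 2) (by omega)
  obtain ⟨D, hD⟩ := hrun _ le_rfl
  refine ⟨⟨C, hC, (hphase hC (by omega)).2.1⟩, D, hD, ?_, ?_⟩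
  · rw [(hphase hD (by omega)).2.2, Nat.add_sub_cancel_left]
  · have hb := streamIAT_received start f seen out hX hX0 hD
    rw [cellRow_eq_none _ _ _ _ (by omega)] at hb
    rw [IAT.run, hD, Option.bind_some, IAT.step, Option.map_eq_none_iff]
    simp [streamIAT, hb, (hphase hD (by omega)).1]

end

/-- Apply the streaming array to the tracked automaton with `X = w.length * k`. Filled registers
persist, so the time bound makes row `X` show the complete output of every pair; conversely, what
this row shows is genuine acceptance and output. -/
theorem CAT.transduction_mem_familyIATltlt {A : Type u} {B : Type v} (M : CAT A B)
    {k : ℕ} (hk : 1 ≤ k) (hM : M.HasTime (fun n => k * n) (fun n => k * n)) :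
    M.transduction ∈ familyIATltlt A B := by
  have := M.finite_S
  let start := Tracked.start M k
  let N : IAT A B := streamIAT start Tracked.next (fun s => s.count.val = k) Tracked.seen Tracked.out
  have hX : ∀ w : List A, ∀ t s, cellRow start Tracked.next w t 0 = some s →
      (s.count.val = k ↔ t = w.length * k) := by
    intro w t s hs
    have hw : (0 : ℤ) ≤ 0 ∧ (0 : ℤ) < w.length :=
      (cellRow_isSome start Tracked.next w t 0).1 (by rw [hs]; rfl)
    obtain ⟨s', hs', -, -, -, h⟩ := M.cellRow_tracked hk w t ⟨0, by omega⟩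
    have : s' = s := by
      rw [← Option.some_inj, ← hs, ← hs']; rfl
    subst this
    rw [h]
    dsimp only
    -- The signal enters the leftmost cell at time `(w.length - 1) * k` and its counter reads `k`
    -- exactly `k` steps later.
    have e : w.length = (w.length - 1 - 0) + 1 := by omega
    conv_rhs => rw [e, add_mul, one_mul]
    omega
  have hX0 : ∀ w : List A, 0 < w.length * k ↔ w ≠ [] := fun w => by
    rw [← List.length_pos_iff]
    exact ⟨fun h => Nat.pos_of_mul_pos_right h, fun h => Nat.mul_pos h hk⟩
  have hseen : ∀ w : List A, w ≠ [] →
      ((∃ s, cellRow start Tracked.next w (w.length * k) 0 = some s ∧ s.seen) ↔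
        ∃ t ≤ w.length * k, M.AcceptsAt w t) := by
    intro w hw
    obtain ⟨s, hs, -, -, h, -⟩ :=
      M.cellRow_tracked hk w (w.length * k) ⟨0, List.length_pos_iff.2 hw⟩
    simp only [Nat.cast_zero] at hs
    simp only [start, hs, Option.some.injEq, exists_eq_left', h, AcceptsAt,
      List.length_pos_iff.2 hw, exists_true_left]
  have hout : ∀ (w : List A) (i : Fin w.length),
      cellOut start Tracked.next Tracked.out w (w.length * k) i =
        (M.run w (w.length * k)).out i := by
    intro w i
    obtain ⟨s, hs, -, h, -⟩ := M.cellRow_tracked hk w (w.length * k) i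
    rw [cellOut, hs, Option.bind_some, h]
  have hemit : ∀ w v, M.EmitsAt w v (w.length * k) ↔
      (∀ j < w.length, (cellOut start Tracked.next Tracked.out w (w.length * k) j).isSome) ∧
      v = ((List.range w.length).map fun j =>
        (cellOut start Tracked.next Tracked.out w (w.length * k) j).getD []).flatten := by
    intro w v
    have hl : ∀ x : Fin w.length → List B, (∀ i, (M.run w (w.length * k)).out i = some (x i)) →
        (List.range w.length).map (fun j =>
          (cellOut start Tracked.next Tracked.out w (w.length * k) j).getD []) = List.ofFn x := by
      intro x hx
      refine List.ext_getElem (by simp) fun i h1 h2 => ?_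
      have := hout w ⟨i, by simpa using h1⟩
      rw [hx] at this
      simp [this]
    constructor
    · rintro ⟨x, hx, rfl⟩
      refine ⟨fun j hj => ?_, by rw [hl x hx]⟩
      rw [hout w ⟨j, hj⟩, hx]; rfl
    · rintro ⟨h1, rfl⟩
      have hx : ∀ i : Fin w.length, (M.run w (w.length * k)).out i =
          some (((M.run w (w.length * k)).out i).getD []) := by
        intro i
        have := h1 i i.isLt
        rw [hout] at this
        obtain ⟨x, hx⟩ := Option.isSome_iff_exists.1 this
        rw [hx]; rfl
      exact ⟨_, hx, by rw [hl _ hx]⟩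
  have hmono : ∀ w v t t', t ≤ t' → M.EmitsAt w v t → M.EmitsAt w v t' := by
    rintro w v t t' h ⟨x, hx, rfl⟩
    refine ⟨x, ?_, rfl⟩
    induction t', h using Nat.le_induction with
    | base => exact hx
    | succ t' _ ih => intro i; rw [run_succ]; simp [step, ih i]
  have hfun : ∀ w v, (w, v) ∈ M.transduction →
      N.AcceptsAt w (3 * (w.length * k) + 2) ∧
      N.HaltsAt w v (3 * (w.length * k) + 1 + w.length) := by
    intro w v h
    obtain ⟨⟨s, hs, hs'⟩, t, ht, ht'⟩ := hM w v h
    have hs : s ≤ w.length * k := by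
      dsimp only at hs; rw [mul_comm]; exact_mod_cast hs
    have ht : t ≤ w.length * k := by
      dsimp only at ht; rw [mul_comm]; exact_mod_cast ht
    obtain ⟨h1, rfl⟩ := (hemit w v).1 (hmono w v _ _ ht ht')
    exact streamIAT_complete _ _ _ _ (hX w) (hX0 w) h.1 ((hseen w h.1).2 ⟨s, hs, hs'⟩) h1
  have heq : N.transduction = M.transduction := by
    ext ⟨w, v⟩
    constructor
    · rintro ⟨⟨t, ht⟩, t', ht'⟩
      obtain ⟨hw, h⟩ := streamIAT_acceptsAt _ _ _ _ (hX w) (hX0 w) ht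
      obtain ⟨s, -, hs⟩ := (hseen w hw).1 h
      exact ⟨hw, ⟨s, hs⟩, _, (hemit w v).2 (streamIAT_haltsAt _ _ _ _ (hX w) (hX0 w) ht')⟩
    · intro h
      exact ⟨⟨_, (hfun w v h).1⟩, _, (hfun w v h).2⟩
  -- Both times, `3 * n * k + 2` and `3 * n * k + 1 + n`, are at most `(3 * k + 2) * n` because `n ≥
  -- 1`.
  have hlin : IsLinearTime fun n : ℕ => ((3 * k + 2 : ℕ) : ℚ) * n :=
    ⟨_, by exact_mod_cast (by omega : 1 ≤ 3 * k + 2), fun _ => rfl⟩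
  refine ⟨_, _, hlin, hlin, N, fun w v h => ?_, heq⟩
  rw [heq] at h
  have hlen := List.length_pos_iff.2 h.1
  have e : (3 * k + 2) * w.length = 3 * (w.length * k) + 2 * w.length := by ring
  dsimp only at hlen
  refine ⟨⟨_, ?_, (hfun w v h).1⟩, _, ?_, (hfun w v h).2⟩ <;> dsimp only
  · exact_mod_cast (by omega : 3 * (w.length * k) + 2 ≤ (3 * k + 2) * w.length)
  · exact_mod_cast (by omega : 3 * (w.length * k) + 1 + w.length ≤ (3 * k + 2) * w.length)

/-! ### Simulating an iterative array by blocks of `K` cells -/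

namespace IAT

variable {A : Type u} {B : Type v}

/-- The arguments of the transition function of the communication cell. -/
abbrev Event (M : IAT A B) (D : Type) := Option D × M.S × M.S

/-- The cell states of a cellular automaton simulating the iterative array `M`: an input symbol,
the states of a block of `K` cells of `M`, as far as they are known, a message to the right
neighbour (either an event, or the message that `M` has halted), and a list of at most `K` events
whose output belongs to the cell. -/
structure Block (M : IAT A B) (D : Type) (K : ℕ) where
  inp : Option D
  sim : Fin K → Option M.S
  msg : Option (Option (M.Event D))
  buf : {l : List (M.Event D) // l.length ≤ K}

namespace Block

variable {M : IAT A B} {D : Type} {K : ℕ}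

instance [Finite D] : Finite (M.Block D K) := by
  have := M.finite_S
  have : Finite {l : List (M.Event D) // l.length ≤ K} := List.finite_length_le _ _
  refine Finite.of_injective (fun s : M.Block D K => (s.inp, s.sim, s.msg, s.buf)) ?_
  rintro ⟨⟩ ⟨⟩ h
  simpa using h

/-- The state of the `r`-th cell of the block. -/
def get (c : M.Block D K) (r : ℕ) : Option M.S :=
  if h : r < K then c.sim ⟨r, h⟩ else none

variable (e : A ≃ D)

/-- The value of the transition function of the communication cell at an event. -/
def value (E : M.Event D) : Option (List B × M.S) :=
  M.δ₀ (E.1.map e.symm) E.2.1 E.2.2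

/-- The output of an event. -/
def word (E : M.Event D) : List B :=
  ((value e E).map Prod.fst).getD []

/-- The next event, if the block contains the communication cell. -/
def event (c : M.Block D K) : Option (M.Event D) :=
  (c.get 0).bind fun s => (c.get 1).map fun s' => (c.inp, s, s')

/-- The message received in the next step; the leftmost block generates it. -/
def received (l : Option (M.Block D K)) (c : M.Block D K) : Option (Option (M.Event D)) :=
  l.elim (c.event.map fun E => if (value e E).isSome then some E else none) msg

/-- The local transition function of the simulating cellular automaton. -/
def next (l : Option (M.Block D K)) (c : M.Block D K) (r : Option (M.Block D K)) :
    M.Block D K where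
  inp := r.bind inp
  sim q :=
    if q.val = 0 ∧ l.isNone then c.event.bind fun E => (value e E).map Prod.snd else
    (if q.val = 0 then l.bind fun l => l.get (K - 1) else c.get (q - 1)).bind fun a =>
    (c.get q).bind fun b =>
    (if q + 1 < K then c.get (q + 1) else r.bind fun r => r.get 0).map fun d => M.δ a b d
  msg := match received e l c with
    | some (some E) => if c.buf.1.length < K then none else some (some E)
    | x => x
  buf := match received e l c with
    | some (some E) => if h : c.buf.1.length < K then ⟨c.buf.1 ++ [E], by simp; omega⟩ else c.buf
    | _ => c.buf

end Block

/-- The cellular automaton transducer in which each cell simulates `K` cells of `M`. -/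
def toCAT [Nonempty A] (M : IAT A B) {D : Type} [Finite D] (e : A ≃ D) (K : ℕ) : CAT A B where
  S := M.Block D K
  finite_S := inferInstance
  nonempty_S := ⟨⟨none, fun _ => none, none, ⟨[], K.zero_le⟩⟩⟩
  F := {c | ∃ s ∈ c.get 0, s ∈ M.F}
  input := ⟨fun a => ⟨some (e a), fun _ => some M.s₀, none, ⟨[], K.zero_le⟩⟩,
    fun a b h => by simpa using h⟩
  δ l c r := (Block.next e l c r,
    match Block.received e l c with
    | some none => some (c.buf.1.map (Block.word e)).flatten
    | _ => none)

variable [Nonempty A] (M : IAT A B) {D : Type} [Finite D] (e : A ≃ D) (K : ℕ) (w : List A)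

/-- The state of cell `i` of the simulating automaton. -/
def block (t : ℕ) (i : Fin w.length) : M.Block D K :=
  ((M.toCAT e K).run w t).state i

theorem block_zero (i : Fin w.length) :
    M.block e K w 0 i = ⟨some (e w[i]), fun _ => some M.s₀, none, ⟨[], K.zero_le⟩⟩ :=
  rfl

theorem block_succ (t : ℕ) (i : Fin w.length) :
    M.block e K w (t + 1) i = Block.next e
      (if i.val = 0 then none else some (M.block e K w t ⟨i.val - 1, by omega⟩))
      (M.block e K w t i)
      (if h : i.val + 1 < w.length then some (M.block e K w t ⟨i.val + 1, h⟩) else none) := by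
  simp only [block, CAT.run_succ]; rfl

theorem block_inp (t : ℕ) (i : Fin w.length) :
    (M.block e K w t i).inp = w[i + t]?.map e := by
  induction t generalizing i with
  | zero => simp [block_zero]
  | succ t ih =>
    rw [block_succ]
    simp only [Block.next]
    split_ifs with h
    · rw [Option.bind_some, ih]
      congr 2
      dsimp only
      omega
    · rw [Option.bind_none, List.getElem?_eq_none (by omega)]; rfl

/-- The state of cell `j` of `M` as known to the simulating automaton. -/
def known (t j : ℕ) : Option M.S :=
  if h : j / K < w.length then (M.block e K w t ⟨j / K, h⟩).get (j % K) else none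

variable {K}

theorem known_mul_add (t a : ℕ) {b : ℕ} (hb : b < K) :
    M.known e K w t (a * K + b) =
      if h : a < w.length then (M.block e K w t ⟨a, h⟩).get b else none := by
  have h1 : (a * K + b) / K = a := by
    rw [mul_comm, Nat.mul_add_div (by omega), Nat.div_eq_of_lt hb, add_zero]
  have h2 : (a * K + b) % K = b := by
    rw [mul_comm, Nat.mul_add_mod, Nat.mod_eq_of_lt hb]
  simp only [known, h1, h2]

theorem known_of_le (t : ℕ) {j : ℕ} (h : w.length * K ≤ j) : M.known e K w t j = none := by
  rcases K.eq_zero_or_pos with rfl | hK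
  · simp [known, Block.get]
  · rw [known, dif_neg]
    rw [not_lt]
    exact (Nat.le_div_iff_mul_le hK).2 h

variable {w}

theorem known_zero {j : ℕ} (h : j < w.length * K) : M.known e K w 0 j = some M.s₀ := by
  have hK : 0 < K := Nat.pos_of_mul_pos_left (by omega : 0 < w.length * K)
  rw [known, dif_pos ((Nat.div_lt_iff_lt_mul hK).2 h)]
  simp [Block.get, Nat.mod_lt _ hK, block_zero]

theorem known_succ_zero (hK : 0 < K) (t : ℕ) (hw : 0 < w.length) :
    M.known e K w (t + 1) 0 =
      (M.block e K w t ⟨0, hw⟩).event.bind fun E => (Block.value e E).map Prod.snd := by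
  have := M.known_mul_add e w (t + 1) 0 hK
  rw [zero_mul, add_zero, dif_pos hw] at this
  rw [this, block_succ]
  simp [Block.get, hK, Block.next]

/-- Across block borders the neighbouring block supplies the missing state, so the partition into
blocks disappears and the known states follow the rule of `M`. -/
theorem known_succ (t : ℕ) {j : ℕ} (hj : 0 < j) (h : j < w.length * K) :
    M.known e K w (t + 1) j =
      (M.known e K w t (j - 1)).bind fun a => (M.known e K w t j).bind fun b =>
        (M.known e K w t (j + 1)).map fun d => M.δ a b d := by
  have hK : 0 < K := Nat.pos_of_mul_pos_left (by omega : 0 < w.length * K)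
  obtain ⟨i, q, hq, rfl⟩ : ∃ i q, q < K ∧ j = i * K + q :=
    ⟨j / K, j % K, Nat.mod_lt _ hK, (Nat.div_add_mod' j K).symm⟩
  have hi : i < w.length := by
    by_contra hi
    have := Nat.mul_le_mul_right K (not_lt.1 hi)
    omega
  have e1 : M.known e K w t (i * K + q - 1) =
      if q = 0 then (if i = 0 then none else some (M.block e K w t ⟨i - 1, by omega⟩)).bind
        (fun l => l.get (K - 1)) else (M.block e K w t ⟨i, hi⟩).get (q - 1) := by
    by_cases h0 : q = 0
    · subst h0
      rw [if_pos rfl]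
      obtain ⟨i, rfl⟩ : ∃ i', i = i' + 1 :=
        ⟨i - 1, by have : i ≠ 0 := by { rintro rfl; omega }
                   omega⟩
      have : (i + 1) * K + 0 - 1 = i * K + (K - 1) := by rw [add_mul]; omega
      rw [this, known_mul_add _ _ _ _ _ (by omega), dif_pos (by omega)]
      simp
    · rw [if_neg h0, Nat.add_sub_assoc (by omega), known_mul_add _ _ _ _ _ (by omega), dif_pos hi]
  have e2 : M.known e K w t (i * K + q) = (M.block e K w t ⟨i, hi⟩).get q := by
    rw [known_mul_add _ _ _ _ _ hq, dif_pos hi]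
  have e3 : M.known e K w t (i * K + q + 1) =
      if q + 1 < K then (M.block e K w t ⟨i, hi⟩).get (q + 1) else
        (if h : i + 1 < w.length then some (M.block e K w t ⟨i + 1, h⟩) else none).bind
          (fun l => l.get 0) := by
    by_cases h0 : q + 1 < K
    · rw [if_pos h0, add_assoc, known_mul_add _ _ _ _ _ h0, dif_pos hi]
    · have : i * K + q + 1 = (i + 1) * K + 0 := by rw [add_mul]; omega
      rw [if_neg h0, this, known_mul_add _ _ _ _ _ hK]
      split_ifs <;> rfl
  rw [e1, e2, e3, known_mul_add _ _ _ _ _ hq, dif_pos hi, block_succ]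
  conv_lhs => rw [Block.get, dif_pos hq]
  simp only [Block.next]
  -- The special branch concerns only the communication cell, excluded by `0 < j`.
  rw [if_neg]
  rintro ⟨rfl, h0⟩
  split_ifs at h0 with h1
  · subst h1; omega
  · simp at h0

/-- Ignorance enters at cell `w.length * K` and moves left by one cell per step. It also crosses
into cell `0`, whose update requires the state of cell `1`; `2 ≤ K` places both in the first block.
-/
theorem known_eq_none (hK : 2 ≤ K) (t : ℕ) {j : ℕ} (h : w.length * K ≤ j + t) :
    M.known e K w t j = none := by
  induction t generalizing j with
  | zero => exact M.known_of_le e w 0 h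
  | succ t ih =>
    by_cases hj : w.length * K ≤ j
    · exact M.known_of_le e w _ hj
    have h1 := ih (j := j + 1) (by omega)
    rcases j.eq_zero_or_pos with rfl | hj0
    · have hw : 0 < w.length := Nat.pos_of_mul_pos_right (by omega : 0 < w.length * K)
      rw [known_succ_zero _ _ (by omega) _ hw]
      have := M.known_mul_add (K := K) e w t 0 (b := 1) (by omega)
      rw [zero_mul, h1, dif_pos hw] at this
      simp [Block.event, ← this]
    · rw [known_succ _ _ _ hj0 (by omega), h1]
      simp

theorem block_event (hK : 2 ≤ K) (t : ℕ) (hw : 0 < w.length) :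
    (M.block e K w t ⟨0, hw⟩).event = (M.known e K w t 0).bind fun s =>
      (M.known e K w t 1).map fun s' => (w[t]?.map e, s, s') := by
  have h0 := M.known_mul_add (K := K) e w t 0 (b := 0) (by omega)
  have h1 := M.known_mul_add (K := K) e w t 0 (b := 1) (by omega)
  rw [zero_mul, dif_pos hw] at h0 h1
  rw [h0, h1, Block.event, block_inp]
  simp

theorem known_eq_some (hK : 2 ≤ K) (t : ℕ) {C : M.Config} (hC : M.run w t = some C) {j : ℕ}
    (h : j + t < w.length * K) : M.known e K w t j = some (C.state j) := by
  induction t generalizing j C with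
  | zero => cases hC; exact M.known_zero e h
  | succ t ih =>
    obtain ⟨C, r, hC', hr, rfl⟩ := run_succ_eq_some.1 hC
    cases j with
    | zero =>
      have hw : 0 < w.length := Nat.pos_of_mul_pos_right (by omega : 0 < w.length * K)
      rw [known_succ_zero _ _ (by omega) _ hw, block_event _ _ hK, ih hC' (by omega),
        ih hC' (by omega)]
      have : (w[t]?.map e).map e.symm = w[t]? := by simp [Function.comp_def]
      simp [Block.value, hr, nextState, Function.comp_def]
    | succ j =>
      rw [known_succ _ _ _ (by omega) (by omega), ih hC' (by omega), ih hC' (by omega),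
        ih hC' (by omega)]
      rfl

/-- When `δ₀` is undefined the communication cell becomes unknown and stays so; hence halting is
reported only once. -/
theorem known_zero_eq_none (hK : 2 ≤ K) (t : ℕ) (h : M.run w t = none) :
    M.known e K w t 0 = none := by
  induction t with
  | zero => simp [run] at h
  | succ t ih =>
    rcases Nat.eq_zero_or_pos w.length with hw | hw
    · exact M.known_of_le e w _ (by simp [hw])
    rw [known_succ_zero _ _ (by omega) _ hw, block_event _ _ hK]
    rcases hC : M.run w t with _ | C
    · rw [ih hC]; rfl
    by_cases ht : 1 + t < w.length * K
    · rw [M.known_eq_some e hK t hC ht, M.known_eq_some e hK t hC (by omega)]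
      rw [run, hC, Option.bind_some, step, Option.map_eq_none_iff] at h
      simp [Block.value, Function.comp_def, h]
    · rw [M.known_eq_none e hK t (j := 1) (by omega)]
      simp

end IAT

/-! ### Distributing the output over the registers -/

namespace IAT

variable {A : Type u} {B : Type v} (M : IAT A B) {D : Type} (e : A ≃ D)
  {K : ℕ} {w : List A}

/-- The arguments of the transition function of the communication cell at time `t`. -/
def eventAt (w : List A) (t : ℕ) : M.Event D :=
  ((M.run w t).map fun C => (w[t]?.map e, C.state 0, C.state 1)).getD (none, M.s₀, M.s₀)

theorem value_eventAt {t : ℕ} {C : M.Config} (hC : M.run w t = some C) :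
    Block.value e (M.eventAt e w t) = M.δ₀ w[t]? (C.state 0) (C.state 1) := by
  simp [eventAt, hC, Block.value, Function.comp_def]

theorem isSome_value_eventAt {t : ℕ} {C : M.Config} (hC : M.run w t = some C) :
    (Block.value e (M.eventAt e w t)).isSome = (M.run w (t + 1)).isSome := by
  rw [M.value_eventAt e hC, run, hC, Option.bind_some, step, Option.isSome_map]

theorem out_eq {t : ℕ} {C : M.Config} (hC : M.run w t = some C) :
    C.out = ((List.Ico 0 t).map fun s => Block.word e (M.eventAt e w s)).flatten := by
  induction t generalizing C with
  | zero => cases hC; simp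
  | succ t ih =>
    obtain ⟨C, r, hC', hr, rfl⟩ := run_succ_eq_some.1 hC
    rw [List.Ico.succ_top t.zero_le]
    have hw : Block.word e (M.eventAt e w t) = r.1 := by
      simp [Block.word, M.value_eventAt e hC', hr]
    simp [ih hC', hw]

/-- The message received by block `i` at time `t` if `M` halts at time `T`. -/
def msgAt (w : List A) (K T i t : ℕ) : Option (Option (M.Event D)) :=
  if t = T + i then some none
  else if i + i * K ≤ t ∧ t < T + i then some (some (M.eventAt e w (t - i))) else none

variable [Nonempty A] [Finite D]

theorem event_of_some (hK : 2 ≤ K) (hw : 0 < w.length) {t : ℕ} {C : M.Config}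
    (hC : M.run w t = some C) (ht : t + 1 < w.length * K) :
    (M.block e K w t ⟨0, hw⟩).event = some (M.eventAt e w t) := by
  rw [block_event _ _ hK, M.known_eq_some e hK t hC (by omega),
    M.known_eq_some e hK t hC (by omega)]
  simp [eventAt, hC]

theorem event_of_none (hK : 2 ≤ K) (hw : 0 < w.length) {t : ℕ}
    (h : M.run w t = none ∨ w.length * K ≤ t + 1) :
    (M.block e K w t ⟨0, hw⟩).event = none := by
  rw [block_event _ _ hK]
  rcases h with h | h
  · rw [M.known_zero_eq_none e hK t h]; rfl
  · rw [M.known_eq_none e hK t (j := 1) (by omega)]; simp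

theorem received_zero (hK : 2 ≤ K) (hw : 0 < w.length) {T : ℕ} (hT : T + 1 < w.length * K)
    {C : M.Config} (hC : M.run w T = some C) (hN : M.run w (T + 1) = none) (t : ℕ) :
    Block.received e none (M.block e K w t ⟨0, hw⟩) = M.msgAt e w K T 0 t := by
  have hnone : ∀ t, T < t → M.run w t = none := by
    intro t ht
    induction t, ht using Nat.le_induction with
    | base => exact hN
    | succ t _ ih => rw [run, ih]; rfl
  have hsome : ∀ t ≤ T, ∃ C, M.run w t = some C := by
    intro t ht
    induction ht using Nat.decreasingInduction with
    | self => exact ⟨C, hC⟩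
    | of_succ t _ ih =>
      obtain ⟨C, hC⟩ := ih
      obtain ⟨C, -, h, -⟩ := run_succ_eq_some.1 hC
      exact ⟨C, h⟩
  rw [msgAt, Block.received, Option.elim_none]
  rcases lt_trichotomy t T with ht | rfl | ht
  · obtain ⟨C, hC⟩ := hsome t ht.le
    obtain ⟨C', hC'⟩ := hsome (t + 1) ht
    rw [M.event_of_some e hK hw hC (by omega), Option.map_some, M.isSome_value_eventAt e hC, hC',
      Option.isSome_some, if_pos rfl, if_neg (by omega), if_pos (by rw [zero_mul]; omega)]
    rfl
  · rw [M.event_of_some e hK hw hC (by omega), Option.map_some, M.isSome_value_eventAt e hC, hN]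
    simp
  · rw [M.event_of_none e hK hw (.inl (hnone t ht)), if_neg (by omega), if_neg (by omega)]
    rfl

theorem toCAT_out_succ (t : ℕ) (i : Fin w.length) :
    ((M.toCAT e K).run w (t + 1)).out i =
      match ((M.toCAT e K).run w t).out i with
      | some x => some x
      | none =>
        match Block.received e
          (if i.val = 0 then none else some (M.block e K w t ⟨i.val - 1, by omega⟩))
          (M.block e K w t i) with
        | some none => some ((M.block e K w t i).buf.1.map (Block.word e)).flatten
        | _ => none := by
  rw [CAT.run_succ]; rfl

/-- The event of time `s` would reach block `i` at time `s + i`. The first `i * K` events are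
retained by earlier blocks, so block `i` retains those from `i * K` up to `(i + 1) * K`, cut off at
`T`. The halting message follows the last event and arrives at time `T + i`, when the buffer is
final. -/
theorem block_spec (hK : 2 ≤ K) {T : ℕ} (hT : T + 1 < w.length * K)
    {C : M.Config} (hC : M.run w T = some C) (hN : M.run w (T + 1) = none) (t : ℕ)
    (i : Fin w.length) :
    (M.block e K w t i).msg = M.msgAt e w K T (i + 1) t ∧
    (M.block e K w t i).buf.1 =
      (List.Ico (i * K) (min (t - i) (min T ((i + 1) * K)))).map (M.eventAt e w) ∧
    ((M.toCAT e K).run w t).out i = if T + i < t then some (((List.Ico (i * K)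
      (min T ((i + 1) * K))).map fun s => Block.word e (M.eventAt e w s)).flatten) else none := by
  induction t generalizing i with
  | zero =>
    refine ⟨?_, ?_, ?_⟩
    · rw [msgAt, if_neg (by omega), if_neg (by omega)]; rfl
    · rw [List.Ico.eq_nil_of_le (by omega)]; rfl
    · rw [if_neg (by omega)]; rfl
  | succ t ih =>
    have hr : Block.received e
        (if i.val = 0 then none else some (M.block e K w t ⟨i.val - 1, by omega⟩))
        (M.block e K w t i) = M.msgAt e w K T i t := by
      by_cases hi : i.val = 0
      · rw [if_pos hi]
        obtain ⟨i, hi'⟩ := i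
        obtain rfl : i = 0 := hi
        exact M.received_zero e hK hi' hT hC hN t
      · rw [if_neg hi]
        have := (ih ⟨i - 1, by omega⟩).1
        rw [Block.received, Option.elim_some, this]
        congr 1
        dsimp only
        omega
    obtain ⟨-, h2, h3⟩ := ih i
    have hlen := congrArg List.length h2
    rw [List.length_map, List.Ico.length] at hlen
    rw [toCAT_out_succ, h3, hr, block_succ]
    simp only [Block.next, hr]
    have hmul : (i.val + 1) * K = i.val * K + K := by ring
    rcases lt_trichotomy t (T + i) with ht | ht | ht
    · have ho : ∀ x y : Option (List B), (if T + i.val < t then x else y) = y :=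
        fun x y => if_neg (by omega)
      have ho' : ∀ x y : Option (List B), (if T + i.val < t + 1 then x else y) = y :=
        fun x y => if_neg (by omega)
      rw [ho, ho']
      by_cases hti : i + i * K ≤ t
      · have hm : M.msgAt e w K T i t = some (some (M.eventAt e w (t - i))) := by
          rw [msgAt, if_neg (by omega), if_pos ⟨hti, ht⟩]
        simp only [hm]
        by_cases hfull : t - i < i * K + K
        · have hlt : (M.block e K w t i).buf.1.length < K := by omega
          rw [if_pos hlt, dif_pos hlt]
          refine ⟨?_, ?_, trivial⟩
          · rw [msgAt, if_neg (by omega), if_neg (by omega)]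
          · have e1 : min (t - i.val) (min T ((i + 1) * K)) = t - i := by omega
            have e2 : min (t + 1 - i.val) (min T ((i + 1) * K)) = t - i + 1 := by omega
            change (M.block e K w t i).buf.1 ++ _ = _
            rw [h2, e1, e2, List.Ico.succ_top (by omega), List.map_append, List.map_singleton]
        · have hlt : ¬ (M.block e K w t i).buf.1.length < K := by omega
          rw [if_neg hlt, dif_neg hlt]
          refine ⟨?_, ?_, trivial⟩
          · rw [msgAt, if_neg (by omega), if_pos (by omega), Nat.add_sub_add_right]
          · rw [h2]
            congr 2
            omega
      · have hm : M.msgAt e w K T i t = none := by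
          rw [msgAt, if_neg (by omega), if_neg (by omega)]
        simp only [hm]
        refine ⟨?_, ?_, trivial⟩
        · rw [msgAt, if_neg (by omega), if_neg (by omega)]
        · rw [h2, List.Ico.eq_nil_of_le (by omega), List.Ico.eq_nil_of_le (by omega)]
    · have hm : M.msgAt e w K T i t = some none := by
        rw [msgAt, if_pos ht]
      simp only [hm]
      refine ⟨?_, ?_, ?_⟩
      · rw [msgAt, if_pos (by omega)]
      · rw [h2]
        congr 2
        omega
      · rw [if_neg (by omega), if_pos (by omega), h2, List.map_map]
        have e1 : min (t - i.val) (min T ((i + 1) * K)) = min T ((i + 1) * K) := by omega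
        rw [e1]
        rfl
    · have hm : M.msgAt e w K T i t = none := by
        rw [msgAt, if_neg (by omega), if_neg (by omega)]
      simp only [hm]
      refine ⟨?_, ?_, ?_⟩
      · rw [msgAt, if_neg (by omega), if_neg (by omega)]
      · rw [h2]
        congr 2
        omega
      · rw [if_pos ht, if_pos (by omega)]

theorem flatten_blocks {β : Type*} (g : ℕ → List β) (T K n : ℕ) :
    (List.ofFn fun i : Fin n =>
      ((List.Ico (i * K) (min T ((i + 1) * K))).map g).flatten).flatten =
      ((List.Ico 0 (min T (n * K))).map g).flatten := by
  induction n with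
  | zero => simp
  | succ n ih =>
    rw [List.ofFn_succ', List.concat_eq_append, List.flatten_append]
    simp only [Fin.val_castSucc, Fin.val_last, List.flatten_singleton]
    rw [ih, ← List.flatten_append, ← List.map_append]
    have : (n + 1) * K = n * K + K := by ring
    rcases le_total T (n * K) with h | h
    · rw [List.Ico.eq_nil_of_le (n := n * K) (by omega), List.append_nil]
      congr 3; omega
    · rw [min_eq_right h, List.Ico.append_consecutive (Nat.zero_le _) (by omega)]

theorem toCAT_acceptsAt (hK : 2 ≤ K) {t : ℕ} :
    (M.toCAT e K).AcceptsAt w t ↔ t < w.length * K ∧ M.AcceptsAt w t := by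
  have hF : ∀ hw : 0 < w.length, ((M.toCAT e K).run w t).state ⟨0, hw⟩ ∈ (M.toCAT e K).F ↔
      ∃ s ∈ M.known e K w t 0, s ∈ M.F := by
    intro hw
    have := M.known_mul_add e w t 0 (b := 0) (K := K) (by omega)
    rw [zero_mul, add_zero, dif_pos hw] at this
    rw [this]
    rfl
  constructor
  · rintro ⟨hw, h⟩
    obtain ⟨s, hs, hs'⟩ := (hF hw).1 h
    rw [Option.mem_def] at hs
    have ht : t < w.length * K := by
      by_contra ht
      rw [M.known_eq_none e hK t (by omega)] at hs
      cases hs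
    refine ⟨ht, ?_⟩
    rcases hC : M.run w t with _ | C
    · rw [M.known_zero_eq_none e hK t hC] at hs
      cases hs
    · rw [M.known_eq_some e hK t hC (by omega)] at hs
      cases hs
      exact ⟨C, hC, hs'⟩
  · rintro ⟨ht, C, hC, h⟩
    have hw : 0 < w.length := Nat.pos_of_mul_pos_right (by omega : 0 < w.length * K)
    exact ⟨hw, (hF hw).2 ⟨_, M.known_eq_some e hK t hC (by omega), h⟩⟩

/-- Only a halting message fills a register, and the leftmost block generates one only when it sees
`M` halt while cells `0` and `1` are still known. Otherwise its register stays empty forever. -/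
theorem toCAT_halts_of_emitsAt (hK : 2 ≤ K) (hw : w ≠ []) {v : List B} {t : ℕ}
    (h : (M.toCAT e K).EmitsAt w v t) :
    ∃ T C, T + 1 < w.length * K ∧ M.run w T = some C ∧ M.run w (T + 1) = none := by
  have hw := List.length_pos_iff.2 hw
  obtain ⟨x, hx, -⟩ := h
  by_contra! hcon
  have hnone : ∀ t, ((M.toCAT e K).run w t).out ⟨0, hw⟩ = none := by
    intro t
    induction t with
    | zero => rfl
    | succ t ih =>
      rw [toCAT_out_succ, ih, if_pos rfl]
      rcases hC : M.run w t with _ | C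
      · simp [Block.received, M.event_of_none e hK hw (.inl hC)]
      · by_cases ht : t + 1 < w.length * K
        · have := Option.isSome_iff_ne_none.2 (hcon t C ht hC)
          simp [Block.received, M.event_of_some e hK hw hC ht, M.isSome_value_eventAt e hC, this]
        · simp [Block.received, M.event_of_none e hK hw (.inr (not_lt.1 ht))]
  have := hx ⟨0, hw⟩
  rw [hnone] at this
  cases this

/-- The `T` events fit into the `w.length` buffers since `T ≤ w.length * K`, and their consecutive
chunks concatenate to the output of `M`. -/
theorem toCAT_emitsAt (hK : 2 ≤ K) {T : ℕ} (hT : T + 1 < w.length * K)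
    {C : M.Config} (hC : M.run w T = some C) (hN : M.run w (T + 1) = none) {v : List B} {t : ℕ} :
    (M.toCAT e K).EmitsAt w v t ↔ T + w.length ≤ t ∧ v = C.out := by
  have hw : 0 < w.length := Nat.pos_of_mul_pos_right (by omega : 0 < w.length * K)
  have hout := fun i => (M.block_spec e hK hT hC hN t i).2.2
  have hv := M.out_eq e hC
  have hfl := flatten_blocks (fun s => Block.word e (M.eventAt e w s)) T K w.length
  rw [min_eq_left (by omega : T ≤ w.length * K), ← hv] at hfl
  constructor
  · rintro ⟨x, hx, rfl⟩
    have ht : T + w.length ≤ t := by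
      -- The last register is the last one to be filled.
      have h1 := hx ⟨w.length - 1, by omega⟩
      rw [hout] at h1
      split_ifs at h1 with h
      dsimp only at h
      omega
    refine ⟨ht, ?_⟩
    rw [← hfl]
    congr 2
    funext i
    have h1 := hx i
    rw [hout, if_pos (by omega)] at h1
    exact (Option.some.inj h1).symm
  · rintro ⟨ht, rfl⟩
    exact ⟨_, fun i => by rw [hout, if_pos (by omega)], hfl.symm⟩

theorem dropEmptyInput_mem_familyCATltlt [Finite A] (M : IAT A B) {k : ℕ}
    (hM : M.HasTime (fun n => k * n) (fun n => k * n)) :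
    M.transduction.dropEmptyInput ∈ familyCATltlt A B := by
  -- The states of a CAT lie in `Type`, whereas `A` lies in an arbitrary universe, so input symbols
  -- are stored through a copy of `A` in `Type`.
  let e := Finite.equivFin A
  -- With `K = k + 2`, halting at a time `T ≤ k * n` gives `T + 1 < n * K` for `n ≥ 1`.
  have hK : 2 ≤ k + 2 := by omega
  have hfun : ∀ w v, (w, v) ∈ M.transduction → w ≠ [] →
      (∃ s ≤ k * w.length, (M.toCAT e (k + 2)).AcceptsAt w s) ∧
      ∃ t ≤ (k + 1) * w.length, (M.toCAT e (k + 2)).EmitsAt w v t := by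
    intro w v h hw
    have hlen := List.length_pos_iff.2 hw
    obtain ⟨⟨s, hs, hs'⟩, t, ht, C, hC, rfl, hN⟩ := hM w v h
    dsimp only at hs ht
    have hs : s ≤ k * w.length := by exact_mod_cast hs
    have ht : t ≤ k * w.length := by exact_mod_cast ht
    have h1 : w.length * (k + 2) = k * w.length + 2 * w.length := by ring
    have h2 : (k + 1) * w.length = k * w.length + w.length := by ring
    exact ⟨⟨s, hs, (M.toCAT_acceptsAt e hK).2 ⟨by omega, hs'⟩⟩,
      t + w.length, by omega, (M.toCAT_emitsAt e hK (by omega) hC hN).2 ⟨le_rfl, rfl⟩⟩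
  have heq : (M.toCAT e (k + 2)).transduction = M.transduction.dropEmptyInput := by
    ext ⟨w, v⟩
    constructor
    · rintro ⟨hw, ⟨s, hs⟩, t, ht⟩
      obtain ⟨T, C, hT, hC, hN⟩ := M.toCAT_halts_of_emitsAt e hK hw ht
      exact ⟨⟨⟨s, ((M.toCAT_acceptsAt e hK).1 hs).2⟩, T, C, hC,
        ((M.toCAT_emitsAt e hK hT hC hN).1 ht).2.symm, hN⟩, hw⟩
    · rintro ⟨h, hw⟩
      obtain ⟨⟨s, -, hs⟩, t, -, ht⟩ := hfun w v h hw
      exact ⟨hw, ⟨s, hs⟩, t, ht⟩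
  have hlin : IsLinearTime fun n : ℕ => ((k + 1 : ℕ) : ℚ) * n :=
    ⟨_, by exact_mod_cast (by omega : 1 ≤ k + 1), fun _ => rfl⟩
  refine ⟨_, _, hlin, hlin, M.toCAT e (k + 2), fun w v h => ?_, heq⟩
  rw [heq] at h
  obtain ⟨⟨s, hs, hs'⟩, t, ht, ht'⟩ := hfun w v h.1 h.2
  have h2 : (k + 1) * w.length = k * w.length + w.length := by ring
  refine ⟨⟨s, ?_, hs'⟩, t, ?_, ht'⟩ <;> dsimp only
  · exact_mod_cast (by omega : s ≤ (k + 1) * w.length)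
  · exact_mod_cast ht

end IAT

/-! ### Integral time bounds and the equality of the families -/

theorem IsLinearTime.exists_nat_le {t₁ t₂ : ℕ → ℚ} (h₁ : IsLinearTime t₁) (h₂ : IsLinearTime t₂) :
    ∃ k : ℕ, 1 ≤ k ∧ (∀ n, t₁ n ≤ k * n) ∧ ∀ n, t₂ n ≤ k * n := by
  obtain ⟨k₁, hk₁, h₁⟩ := h₁
  obtain ⟨k₂, -, h₂⟩ := h₂
  refine ⟨max ⌈k₁⌉₊ ⌈k₂⌉₊, ?_, fun n => ?_, fun n => ?_⟩
  · exact le_max_of_le_left (Nat.one_le_ceil_iff.2 (by linarith))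
  · rw [h₁]
    gcongr
    exact (Nat.le_ceil k₁).trans (by exact_mod_cast le_max_left _ _)
  · rw [h₂]
    gcongr
    exact (Nat.le_ceil k₂).trans (by exact_mod_cast le_max_right _ _)

theorem CAT.HasTime.mono {A : Type u} {B : Type v} {M : CAT A B} {t₁ t₂ t₁' t₂' : ℕ → ℚ}
    (h : M.HasTime t₁ t₂) (h₁ : ∀ n, t₁ n ≤ t₁' n) (h₂ : ∀ n, t₂ n ≤ t₂' n) :
    M.HasTime t₁' t₂' := by
  intro w v hwv
  obtain ⟨⟨s, hs, hs'⟩, t, ht, ht'⟩ := h w v hwv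
  exact ⟨⟨s, hs.trans (h₁ _), hs'⟩, t, ht.trans (h₂ _), ht'⟩

theorem IAT.HasTime.mono {A : Type u} {B : Type v} {M : IAT A B} {t₁ t₂ t₁' t₂' : ℕ → ℚ}
    (h : M.HasTime t₁ t₂) (h₁ : ∀ n, t₁ n ≤ t₁' n) (h₂ : ∀ n, t₂ n ≤ t₂' n) :
    M.HasTime t₁' t₂' := by
  intro w v hwv
  obtain ⟨⟨s, hs, hs'⟩, t, ht, ht'⟩ := h w v hwv
  exact ⟨⟨s, hs.trans (h₁ _), hs'⟩, t, ht.trans (h₂ _), ht'⟩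

theorem mainTheorem3 (A : Type u) (B : Type v) [Finite A] [Nonempty A] [Finite B] :
    Transduction.dropEmptyInput '' familyIATltlt A B =
      Transduction.dropEmptyInput '' familyCATltlt A B := by
  apply Set.Subset.antisymm
  · rintro _ ⟨_, ⟨t₁, t₂, h₁, h₂, M, hM, rfl⟩, rfl⟩
    obtain ⟨k, -, hk₁, hk₂⟩ := h₁.exists_nat_le h₂
    refine ⟨_, M.dropEmptyInput_mem_familyCATltlt (hM.mono hk₁ hk₂), ?_⟩
    ext p
    exact ⟨fun h => h.1, fun h => ⟨h, h.2⟩⟩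
  · rintro _ ⟨_, ⟨t₁, t₂, h₁, h₂, M, hM, rfl⟩, rfl⟩
    obtain ⟨k, hk, hk₁, hk₂⟩ := h₁.exists_nat_le h₂
    exact ⟨_, M.transduction_mem_familyIATltlt hk (hM.mono hk₁ hk₂), rfl⟩
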